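/- Let $R$ be an associative ring with identity, let $\mathrm{Mod}\,R$ and $\mathrm{Mod}\,R^{op}$ be the categories of left and right $R$-modules, and write $M^+=\mathrm{Hom}_{\mathbb Z}(M,\mathbb Q/\mathbb Z)$ for the character module of a left (resp. right) $R$-module $M$, which is a right (resp. left) $R$-module. All subcategories are full, additive (they contain $0$ and are closed under finite direct sums) and closed under isomorphisms. For a subcategory $\mathcal X$ of a module category $\mathcal A$: - the right Gorenstein subcategory $r\mathcal G(\mathcal X)$ consists of all $A$ such that $\mathrm{Ext}^{i}(A,X)=0$ for all $X\in\mathcal X$ and $i\ge 1$, and such that there is an exact sequence $0\to A\to X^0\to X^1\to\cdots$ with all $X^i\in\mathcal X$ which remains exact under $\mathrm{Hom}(-,X)$ for every $X\in\mathcal X$; - the left Gorenstein subcategory $l\mathcal G(\mathcal X)$ consists of all $A$ such that $\mathrm{Ext}^{i}(X,A)=0$ for all $X\in\mathcal X$ and $i\ge 1$, and such that there is an exact sequence $\cdots\to X_1\to X_0\to A\to 0$ with all $X_i\in\mathcal X$ which remains exact under $\mathrm{Hom}(X,-)$ for every $X\in\mathcal X$; - $\mathcal X$ is preenveloping in $\mathcal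 A$ if every $A\in\mathcal A$ admits a morphism $f:A\to X$ with $X\in\mathcal X$ such that $\mathrm{Hom}(f,X'):\mathrm{Hom}(X,X')\to\mathrm{Hom}(A,X')$ is surjective for every $X'\in\mathcal X$. A short exact sequence in $\mathrm{Mod}\,R$ is pure if $\mathrm{Hom}_R(M,-)$ preserves its exactness for every finitely presented $M$; a module $E$ is pure injective if $\mathrm{Hom}_R(-,E)$ preserves exactness of every pure short exact sequence. **Proposition 3.2.** Let $\mathcal C$ and $\mathcal D$ be subcategories of $\mathrm{Mod}\,R$ and $\mathrm{Mod}\,R^{op}$ respectively such that (a) $D^+\in\mathcal C$ for all $D\in\mathcal D$, and $C^+\in\mathcal D$ for all $C\in\mathcal C$; (b) $\mathcal C$ is preenveloping in $\mathrm{Mod}\,R$ and every module in $\mathcal C$ is pure injective; (c) $\mathrm{Ext}^{i}_{R^{op}}(D,C^+)=0$ for all $D\in\mathcal D$, $C\in\mathcal C$ and $i\ge 1$. Then for every $A\in\mathrm{Mod}\,R$, one has $A\in r\mathcal G(\mathcal C)$ if and only if $A^+\in l\mathcal G(\mathcal D)$. -/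

import Mathlib

open CategoryTheory MulOpposite

universe w v u

namespace GorensteinSub

/-! ### Right and left Gorenstein subcategories of an abelian category

A (full) subcategory is given by the property of belonging to it. -/

section AbelianCategory

variable {𝒜 : Type u} [Category.{v} 𝒜] [Abelian 𝒜]

/-- `Ext^{≥ 1}(X, Y) = 0`. -/
def ExtVanish [HasExt.{w} 𝒜] (X Y : 𝒜) : Prop :=
  ∀ n : ℕ, 1 ≤ n → Subsingleton (Abelian.Ext.{w} X Y n)

/-- The orthogonal class `⊥P` of all `A` with `Ext^{≥ 1}(A, X) = 0` for all `X` in `P`. -/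
def leftPerp [HasExt.{w} 𝒜] (P : ObjectProperty 𝒜) : ObjectProperty 𝒜 :=
  fun A => ∀ X : 𝒜, P X → ExtVanish.{w} A X

/-- The orthogonal class `P⊥` of all `A` with `Ext^{≥ 1}(X, A) = 0` for all `X` in `P`. -/
def rightPerp [HasExt.{w} 𝒜] (P : ObjectProperty 𝒜) : ObjectProperty 𝒜 :=
  fun A => ∀ X : 𝒜, P X → ExtVanish.{w} X A

/-- The sequence `0 ⟶ A ⟶ X 0 ⟶ X 1 ⟶ ⋯` with maps `ε` and `d i` is exact. -/
structure IsCoresolution {A : 𝒜} {X : ℕ → 𝒜} (ε : A ⟶ X 0) (d : ∀ i, X i ⟶ X (i + 1)) :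
    Prop where
  mono : Mono ε
  exact_zero : ∃ h : ε ≫ d 0 = 0, (ShortComplex.mk ε (d 0) h).Exact
  exact_succ : ∀ i, ∃ h : d i ≫ d (i + 1) = 0, (ShortComplex.mk (d i) (d (i + 1)) h).Exact

/-- The sequence `⋯ ⟶ Hom(X 1, Y) ⟶ Hom(X 0, Y) ⟶ Hom(A, Y) ⟶ 0` is exact. -/
structure HomIntoExact {A : 𝒜} {X : ℕ → 𝒜} (ε : A ⟶ X 0) (d : ∀ i, X i ⟶ X (i + 1)) (Y : 𝒜) :
    Prop where
  surjective : Function.Surjective (fun g : X 0 ⟶ Y => ε ≫ g)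
  exact_zero : Function.Exact (fun g : X 1 ⟶ Y => d 0 ≫ g) (fun g : X 0 ⟶ Y => ε ≫ g)
  exact_succ : ∀ i, Function.Exact (fun g : X (i + 2) ⟶ Y => d (i + 1) ≫ g)
    (fun g : X (i + 1) ⟶ Y => d i ≫ g)

/-- The class of all `A` with a `Hom(-, P)`-exact exact sequence `0 ⟶ A ⟶ X 0 ⟶ X 1 ⟶ ⋯`
whose terms `X i` all lie in `P`. -/
def coresTilde (P : ObjectProperty 𝒜) : ObjectProperty 𝒜 :=
  fun A => ∃ (X : ℕ → 𝒜) (ε : A ⟶ X 0) (d : ∀ i, X i ⟶ X (i + 1)),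
    (∀ i, P (X i)) ∧ IsCoresolution ε d ∧ ∀ Y : 𝒜, P Y → HomIntoExact ε d Y

/-- The sequence `⋯ ⟶ X 1 ⟶ X 0 ⟶ A ⟶ 0` with maps `d i` and `ε` is exact. -/
structure IsResolution {A : 𝒜} {X : ℕ → 𝒜} (ε : X 0 ⟶ A) (d : ∀ i, X (i + 1) ⟶ X i) :
    Prop where
  epi : Epi ε
  exact_zero : ∃ h : d 0 ≫ ε = 0, (ShortComplex.mk (d 0) ε h).Exact
  exact_succ : ∀ i, ∃ h : d (i + 1) ≫ d i = 0, (ShortComplex.mk (d (i + 1)) (d i) h).Exact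

/-- The sequence `⋯ ⟶ Hom(Y, X 1) ⟶ Hom(Y, X 0) ⟶ Hom(Y, A) ⟶ 0` is exact. -/
structure HomFromExact {A : 𝒜} {X : ℕ → 𝒜} (ε : X 0 ⟶ A) (d : ∀ i, X (i + 1) ⟶ X i) (Y : 𝒜) :
    Prop where
  surjective : Function.Surjective (fun g : Y ⟶ X 0 => g ≫ ε)
  exact_zero : Function.Exact (fun g : Y ⟶ X 1 => g ≫ d 0) (fun g : Y ⟶ X 0 => g ≫ ε)
  exact_succ : ∀ i, Function.Exact (fun g : Y ⟶ X (i + 2) => g ≫ d (i + 1))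
    (fun g : Y ⟶ X (i + 1) => g ≫ d i)

/-- The class of all `A` with a `Hom(P, -)`-exact exact sequence `⋯ ⟶ X 1 ⟶ X 0 ⟶ A ⟶ 0`
whose terms `X i` all lie in `P`. -/
def resTilde (P : ObjectProperty 𝒜) : ObjectProperty 𝒜 :=
  fun A => ∃ (X : ℕ → 𝒜) (ε : X 0 ⟶ A) (d : ∀ i, X (i + 1) ⟶ X i),
    (∀ i, P (X i)) ∧ IsResolution ε d ∧ ∀ Y : 𝒜, P Y → HomFromExact ε d Y

/-- The right Gorenstein subcategory relative to `P`. -/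
def rightGorenstein [HasExt.{w} 𝒜] (P : ObjectProperty 𝒜) : ObjectProperty 𝒜 :=
  fun A => leftPerp.{w} P A ∧ coresTilde P A

/-- The left Gorenstein subcategory relative to `P`. -/
def leftGorenstein [HasExt.{w} 𝒜] (P : ObjectProperty 𝒜) : ObjectProperty 𝒜 :=
  fun A => rightPerp.{w} P A ∧ resTilde P A

/-- The morphism `f : A ⟶ X` is a `P`-preenvelope of `A`. -/
def IsPreenvelope (P : ObjectProperty 𝒜) {A X : 𝒜} (f : A ⟶ X) : Prop :=
  P X ∧ ∀ X' : 𝒜, P X' → Function.Surjective (fun g : X ⟶ X' => f ≫ g)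

/-- Every object of the category has a `P`-preenvelope. -/
def IsPreenveloping (P : ObjectProperty 𝒜) : Prop :=
  ∀ A : 𝒜, ∃ (X : 𝒜) (f : A ⟶ X), IsPreenvelope P f

end AbelianCategory

/-! ### Pure injective modules -/

section Pure

variable {R : Type u} [Ring R]

/-- The short exact sequence `S` is pure: for every finitely presented `M`, the sequence
`0 ⟶ Hom(M, S.X₁) ⟶ Hom(M, S.X₂) ⟶ Hom(M, S.X₃) ⟶ 0` is exact. -/
def IsPureExact (S : ShortComplex (ModuleCat.{u} R)) : Prop :=
  S.ShortExact ∧ ∀ M : ModuleCat.{u} R, Module.FinitePresentation R M →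
    Function.Injective (fun h : M ⟶ S.X₁ => h ≫ S.f) ∧
    Function.Exact (fun h : M ⟶ S.X₁ => h ≫ S.f) (fun h : M ⟶ S.X₂ => h ≫ S.g) ∧
    Function.Surjective (fun h : M ⟶ S.X₂ => h ≫ S.g)

/-- `E` is pure injective: for every pure short exact sequence `S`, the sequence
`0 ⟶ Hom(S.X₃, E) ⟶ Hom(S.X₂, E) ⟶ Hom(S.X₁, E) ⟶ 0` is exact. -/
def IsPureInjective (E : ModuleCat.{u} R) : Prop :=
  ∀ S : ShortComplex (ModuleCat.{u} R), IsPureExact S →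
    Function.Injective (fun h : S.X₃ ⟶ E => S.g ≫ h) ∧
    Function.Exact (fun h : S.X₃ ⟶ E => S.g ≫ h) (fun h : S.X₂ ⟶ E => S.f ≫ h) ∧
    Function.Surjective (fun h : S.X₂ ⟶ E => S.f ≫ h)

end Pure

/-! ### Character modules over a noncommutative ring

`CharacterModule M` is the abelian group `Hom_ℤ(M, ℚ/ℤ)`; right `R`-modules are modules over
`Rᵐᵒᵖ`. -/

section Character

variable {R : Type u} [Ring R]

/-- The character group of a left `R`-module is a right `R`-module via `(f · r)(x) = f (r x)`. -/
abbrev rightModuleCharacter (M : Type u) [AddCommGroup M] [Module R M] :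
    Module Rᵐᵒᵖ (CharacterModule M) where
  smul r f := AddMonoidHom.comp (f : M →+ AddCircle (1 : ℚ))
    (DistribSMul.toAddMonoidHom M (unop r))
  one_smul f := by
    ext x; exact congrArg f (one_smul R x)
  mul_smul r s f := by
    ext x; exact congrArg f (mul_smul (unop s) (unop r) x)
  smul_zero r := rfl
  smul_add r f g := rfl
  add_smul r s f := by
    ext x; exact (congrArg f (add_smul (unop r) (unop s) x)).trans (map_add f _ _)
  zero_smul f := by
    ext x; exact (congrArg f (zero_smul R x)).trans (map_zero f)

/-- The character group of a right `R`-module is a left `R`-module via `(r · f)(x) = f (x r)`. -/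
abbrev leftModuleCharacter (M : Type u) [AddCommGroup M] [Module Rᵐᵒᵖ M] :
    Module R (CharacterModule M) where
  smul r f := AddMonoidHom.comp (f : M →+ AddCircle (1 : ℚ))
    (DistribSMul.toAddMonoidHom M (op r))
  one_smul f := by
    ext x; exact congrArg f (one_smul Rᵐᵒᵖ x)
  mul_smul r s f := by
    ext x; exact congrArg f (mul_smul (op s) (op r) x)
  smul_zero r := rfl
  smul_add r f g := rfl
  add_smul r s f := by
    ext x; exact (congrArg f (add_smul (op r) (op s) x)).trans (map_add f _ _)
  zero_smul f := by
    ext x; exact (congrArg f (zero_smul Rᵐᵒᵖ x)).trans (map_zero f)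

/-- The character module `M⁺` of a left `R`-module `M`, as a right `R`-module. -/
def charRight (M : ModuleCat.{u} R) : ModuleCat.{u} Rᵐᵒᵖ :=
  letI := rightModuleCharacter (R := R) M
  ModuleCat.of Rᵐᵒᵖ (CharacterModule M)

/-- The character module `N⁺` of a right `R`-module `N`, as a left `R`-module. -/
def charLeft (N : ModuleCat.{u} Rᵐᵒᵖ) : ModuleCat.{u} R :=
  letI := leftModuleCharacter (R := R) N
  ModuleCat.of R (CharacterModule N)

end Character

end GorensteinSub

namespace GorensteinSub

/-!
The pairing isomorphism `Hom(A, D⁺) ≅ Hom(D, A⁺)` and the exactness of `(-)⁺` turn the vanishing of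
`Ext(A, D⁺)` into that of `Ext(D, A⁺)`, and coresolutions of `A` in `𝒞` into resolutions of `A⁺`
in `𝒟`. Since a pure injective `C` is a direct summand of `C⁺⁺`, vanishing of `Ext(A, -)` on the
modules `D⁺` implies vanishing on `𝒞`.

Conversely, suppose `A⁺` has a proper resolution in `𝒟`, and let `A ⟶ X` be a `𝒞`-preenvelope.
A surjection `D ⟶ A⁺` with `D` in `𝒟` transposes to an injection `A ⟶ D⁺`, which factors through
`X`, so `A ⟶ X` is injective. The dual sequence `0 ⟶ (X/A)⁺ ⟶ X⁺ ⟶ A⁺ ⟶ 0` is a proper first step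
of a resolution of `A⁺`, so by Schanuel's lemma `(X/A)⁺` has a proper resolution too, and the
construction can be repeated with `X/A` in place of `A`.
-/

open Limits Abelian

section AbelianCategory

variable {𝒜 : Type u} [Category.{v} 𝒜] [Abelian 𝒜]

lemma exact_comp_mono_iff {X Y Z W : 𝒜} {f : X ⟶ Y} {g : Y ⟶ Z} (m : Z ⟶ W) [Mono m]
    (h : f ≫ g = 0) (h' : f ≫ g ≫ m = 0) :
    (ShortComplex.mk f (g ≫ m) h').Exact ↔ (ShortComplex.mk f g h).Exact :=
  let φ : ShortComplex.mk f g h ⟶ ShortComplex.mk f (g ≫ m) h' :=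
    { τ₁ := 𝟙 X, τ₂ := 𝟙 Y, τ₃ := m }
  have : Epi φ.τ₁ := inferInstanceAs (Epi (𝟙 X))
  have : IsIso φ.τ₂ := inferInstanceAs (IsIso (𝟙 Y))
  have : Mono φ.τ₃ := ‹Mono m›
  (ShortComplex.exact_iff_of_epi_of_isIso_of_mono φ).symm

lemma exact_epi_comp_iff {W X Y Z : 𝒜} (e : W ⟶ X) [Epi e] {f : X ⟶ Y} {g : Y ⟶ Z}
    (h : f ≫ g = 0) (h' : (e ≫ f) ≫ g = 0) :
    (ShortComplex.mk (e ≫ f) g h').Exact ↔ (ShortComplex.mk f g h).Exact :=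
  let φ : ShortComplex.mk (e ≫ f) g h' ⟶ ShortComplex.mk f g h :=
    { τ₁ := e, τ₂ := 𝟙 Y, τ₃ := 𝟙 Z }
  have : Epi φ.τ₁ := ‹Epi e›
  have : IsIso φ.τ₂ := inferInstanceAs (IsIso (𝟙 Y))
  have : Mono φ.τ₃ := inferInstanceAs (Mono (𝟙 Z))
  ShortComplex.exact_iff_of_epi_of_isIso_of_mono φ

section Splicing

variable {Z X : ℕ → 𝒜} {f : ∀ i, Z i ⟶ X i} {p : ∀ i, X i ⟶ Z (i + 1)}
  {w : ∀ i, f i ≫ p i = 0}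

lemma isCoresolution_of_shortExact (hS : ∀ i, (ShortComplex.mk (f i) (p i) (w i)).ShortExact) :
    IsCoresolution (f 0) (fun i => p i ≫ f (i + 1)) := by
  have : ∀ i, Mono (f i) := fun i => (hS i).mono_f
  have : ∀ i, Epi (p i) := fun i => (hS i).epi_g
  have zero : ∀ i, f i ≫ p i ≫ f (i + 1) = 0 := fun i => by rw [reassoc_of% w i, zero_comp]
  have exact : ∀ i, (ShortComplex.mk (f i) (p i ≫ f (i + 1)) (zero i)).Exact := fun i =>
    (exact_comp_mono_iff _ (w i) _).2 (hS i).exact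
  exact ⟨inferInstance, ⟨zero 0, exact 0⟩, fun i =>
    ⟨by rw [Category.assoc, zero, comp_zero], (exact_epi_comp_iff _ (zero (i + 1)) _).2 (exact _)⟩⟩

lemma homIntoExact_of_shortExact (hS : ∀ i, (ShortComplex.mk (f i) (p i) (w i)).ShortExact)
    {Y : 𝒜} (hY : ∀ i, Function.Surjective (fun g : X i ⟶ Y => f i ≫ g)) :
    HomIntoExact (f 0) (fun i => p i ≫ f (i + 1)) Y := by
  have exact : ∀ i, Function.Exact (fun g : X (i + 1) ⟶ Y => (p i ≫ f (i + 1)) ≫ g)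
      (fun g : X i ⟶ Y => f i ≫ g) := fun i g => by
    constructor
    · intro hg
      have := (hS i).epi_g
      obtain ⟨g', hg'⟩ := hY (i + 1) ((hS i).exact.desc g hg)
      exact ⟨g', by simpa [← hg'] using (hS i).exact.g_desc g hg⟩
    · rintro ⟨g', rfl⟩
      simp [reassoc_of% w i]
  refine ⟨hY 0, exact 0, fun i g => ?_⟩
  have : Epi (p i) := (hS i).epi_g
  rw [← exact (i + 1) g, ← cancel_epi (p i), comp_zero, ← Category.assoc]

end Splicing

variable {P : ObjectProperty 𝒜}

lemma coresTilde_of_forall_exists_preenvelope {Q : ObjectProperty 𝒜}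
    (step : ∀ A, Q A → ∃ (X B : 𝒜) (f : A ⟶ X) (p : X ⟶ B) (w : f ≫ p = 0),
      IsPreenvelope P f ∧ (ShortComplex.mk f p w).ShortExact ∧ Q B) {A : 𝒜} (hA : Q A) :
    coresTilde P A := by
  choose X B f p w hf hS hB using fun Z : {A : 𝒜 // Q A} => step Z.1 Z.2
  let Z : ℕ → {A : 𝒜 // Q A} := fun n => Nat.rec ⟨A, hA⟩ (fun _ Z => ⟨B Z, hB Z⟩) n
  exact ⟨fun i => X (Z i), f (Z 0), fun i => p (Z i) ≫ f (Z (i + 1)), fun i => (hf (Z i)).1,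
    isCoresolution_of_shortExact fun i => hS (Z i),
    fun Y hY => homIntoExact_of_shortExact (fun i => hS (Z i)) fun i => (hf (Z i)).2 Y hY⟩

/-- A short exact sequence which remains exact under `Hom(Y, -)` for all `Y` in `P`; these are the
pieces of the resolutions in `resTilde P`. -/
structure IsProperExact (P : ObjectProperty 𝒜) (S : ShortComplex 𝒜) : Prop where
  shortExact : S.ShortExact
  surjective : ∀ Y : 𝒜, P Y → Function.Surjective (fun g : Y ⟶ S.X₂ => g ≫ S.g)

lemma resTilde_of_isProperExact {S : ShortComplex 𝒜} (hS : IsProperExact P S) (hX : P S.X₂)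
    (hK : resTilde P S.X₁) : resTilde P S.X₃ := by
  obtain ⟨X, ε, d, hXP, hres, hom⟩ := hK
  have := hS.shortExact.mono_f
  have := hres.epi
  have zero : (ε ≫ S.f) ≫ S.g = 0 := by rw [Category.assoc, S.zero, comp_zero]
  let X' : ℕ → 𝒜 := fun | 0 => S.X₂ | n + 1 => X n
  let d' : ∀ i, X' (i + 1) ⟶ X' i := fun | 0 => ε ≫ S.f | n + 1 => d n
  refine ⟨X', S.g, d', fun | 0 => hX | n + 1 => hXP n,
    ⟨hS.shortExact.epi_g, ⟨zero, ?_⟩, fun | 0 => ?_ | n + 1 => hres.exact_succ n⟩,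
    fun Y hY => ⟨hS.surjective Y hY, fun g => ⟨fun hg => ?_, ?_⟩,
      fun | 0 => fun g => ?_ | n + 1 => (hom Y hY).exact_succ n⟩⟩
  · exact (exact_epi_comp_iff ε S.zero _).2 hS.shortExact.exact
  · obtain ⟨h, hex⟩ := hres.exact_zero
    exact ⟨by simp [d', reassoc_of% h], (exact_comp_mono_iff S.f h _).2 hex⟩
  · obtain ⟨g', hg'⟩ := (hom Y hY).surjective (hS.shortExact.exact.lift g hg)
    exact ⟨g', by simpa [d', ← hg'] using hS.shortExact.exact.lift_f g hg⟩
  · rintro ⟨g', rfl⟩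
    simp [d', S.zero]
  · rw [← (hom Y hY).exact_zero g, ← cancel_mono S.f, zero_comp, Category.assoc]

lemma resTilde.exists_isProperExact {A : 𝒜} (hA : resTilde P A) :
    ∃ (K X : 𝒜) (k : K ⟶ X) (ε : X ⟶ A) (w : k ≫ ε = 0),
      IsProperExact P (ShortComplex.mk k ε w) ∧ P X ∧ resTilde P K := by
  obtain ⟨X, ε, d, hX, hres, hom⟩ := hA
  obtain ⟨h₀, hex₀⟩ := hres.exact_zero
  obtain ⟨h₁, hex₁⟩ := hres.exact_succ 0
  have := hres.epi
  let e : X 1 ⟶ kernel ε := kernel.lift ε (d 0) h₀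
  have he : e ≫ kernel.ι ε = d 0 := kernel.lift_ι _ _ _
  have hde : d 1 ≫ e = 0 := by
    rw [← cancel_mono (kernel.ι ε), Category.assoc, he, h₁, zero_comp]
  refine ⟨kernel ε, X 0, kernel.ι ε, ε, kernel.condition ε,
    ⟨.mk' (ShortComplex.exact_kernel ε) inferInstance inferInstance,
      fun Y hY => (hom Y hY).surjective⟩, hX 0,
    fun i => X (i + 1), e, fun i => d (i + 1), fun i => hX _,
    ⟨(ShortComplex.exact_iff_epi_kernel_lift _).1 hex₀, ⟨hde, ?_⟩,
      fun i => hres.exact_succ (i + 1)⟩,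
    fun Y hY => ⟨fun g => ?_, fun g => ?_, fun i => (hom Y hY).exact_succ (i + 1)⟩⟩
  · simpa only [← he, exact_comp_mono_iff (kernel.ι ε) hde] using hex₁
  · obtain ⟨g', hg'⟩ := ((hom Y hY).exact_zero (g ≫ kernel.ι ε)).1 (by simp)
    exact ⟨g', by simpa [← cancel_mono (kernel.ι ε), he] using hg'⟩
  · rw [← (hom Y hY).exact_succ 0 g, ← he, ← cancel_mono (kernel.ι ε), zero_comp, Category.assoc]

instance : (resTilde P).IsClosedUnderIsomorphisms where
  of_iso {A B} e hA := by
    obtain ⟨K, X, k, ε, w, hS, hX, hK⟩ := hA.exists_isProperExact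
    let S : ShortComplex 𝒜 := .mk k (ε ≫ e.hom) (by rw [reassoc_of% w, zero_comp])
    let φ : ShortComplex.mk k ε w ≅ S := ShortComplex.isoMk (Iso.refl K) (Iso.refl X) e
    have hS' : IsProperExact P S :=
      ⟨ShortComplex.shortExact_of_iso φ hS.shortExact, fun Y hY g => by
        obtain ⟨g', hg'⟩ := hS.surjective Y hY (g ≫ e.inv)
        exact ⟨g', by simpa [S, Iso.eq_comp_inv] using hg'⟩⟩
    exact resTilde_of_isProperExact hS' hX hK

lemma nonempty_pullback_iso_biprod {S : ShortComplex 𝒜} (hS : S.ShortExact) {Y : 𝒜}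
    (s : Y ⟶ S.X₂) {h : Y ⟶ S.X₃} (hs : s ≫ S.g = h) :
    Nonempty (pullback S.g h ≅ S.X₁ ⊞ Y) := by
  have := hS.mono_f
  let r : pullback S.g h ⟶ S.X₁ := hS.exact.lift (pullback.fst S.g h - pullback.snd S.g h ≫ s)
    (by simp [hs, pullback.condition])
  have hr : r ≫ S.f = pullback.fst S.g h - pullback.snd S.g h ≫ s := hS.exact.lift_f _ _
  let i : S.X₁ ⟶ pullback S.g h := pullback.lift S.f 0 (by simp)
  let j : Y ⟶ pullback S.g h := pullback.lift s (𝟙 Y) (by simp [hs])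
  have hi₁ : i ≫ pullback.fst S.g h = S.f := pullback.lift_fst _ _ _
  have hi₂ : i ≫ pullback.snd S.g h = 0 := pullback.lift_snd _ _ _
  have hj₁ : j ≫ pullback.fst S.g h = s := pullback.lift_fst _ _ _
  have hj₂ : j ≫ pullback.snd S.g h = 𝟙 Y := pullback.lift_snd _ _ _
  refine ⟨⟨biprod.lift r (pullback.snd S.g h), biprod.desc i j, ?_, ?_⟩⟩
  · ext <;> simp [hi₁, hi₂, hj₁, hj₂, hr]
  · ext <;> simp [← cancel_mono S.f, hi₁, hi₂, reassoc_of% hi₂, hj₁, hj₂, reassoc_of% hj₂, hr]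

variable [P.IsClosedUnderBinaryProducts]

lemma prop_biprod {X Y : 𝒜} (hX : P X) (hY : P Y) : P (X ⊞ Y) :=
  P.prop_of_isLimit_binaryFan (BinaryBiproduct.isLimit X Y) hX hY

lemma resTilde.biprod {A D : 𝒜} (hA : resTilde P A) (hD : P D) : resTilde P (A ⊞ D) := by
  obtain ⟨K, X, k, ε, w, hS, hX, hK⟩ := hA.exists_isProperExact
  have := hS.shortExact.mono_f
  have := hS.shortExact.epi_g
  let S : ShortComplex 𝒜 := .mk (k ≫ biprod.inl) (biprod.map ε (𝟙 D)) (by simp [reassoc_of% w])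
  have hex : S.Exact := S.exact_of_f_is_kernel <| KernelFork.IsLimit.ofι' _ _ fun x hx =>
    ⟨hS.shortExact.exact.lift (x ≫ biprod.fst) (by simpa [S] using hx =≫ biprod.fst), by
      have : x ≫ biprod.snd = 0 := by simpa [S] using hx =≫ biprod.snd
      ext
      · simpa [S] using hS.shortExact.exact.lift_f _ _
      · simp [S, this]⟩
  have hS' : IsProperExact P S := by
    refine ⟨.mk' hex (mono_comp _ _) inferInstance, fun Y hY g => ?_⟩
    obtain ⟨g', hg'⟩ := hS.surjective Y hY (g ≫ biprod.fst)
    exact ⟨biprod.lift g' (g ≫ biprod.snd), by ext <;> simp [S, ← hg']⟩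
  exact resTilde_of_isProperExact hS' (prop_biprod hX hD) hK

lemma resTilde.of_biprod {A D : 𝒜} (hAD : resTilde P (A ⊞ D)) (hD : P D) : resTilde P A := by
  obtain ⟨K, X, k, ε, w, hS, hX, hK⟩ := hAD.exists_isProperExact
  have := hS.shortExact.epi_g
  obtain ⟨s, hs⟩ := hS.surjective D hD biprod.inr
  obtain ⟨e⟩ := nonempty_pullback_iso_biprod hS.shortExact s hs
  let S : ShortComplex 𝒜 := .mk (pullback.fst ε (biprod.inr : D ⟶ A ⊞ D)) (ε ≫ biprod.fst)
    (by simp [pullback.condition_assoc])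
  have hex : S.Exact := S.exact_of_f_is_kernel <| KernelFork.IsLimit.ofι' _ _ fun x hx =>
    ⟨pullback.lift x (x ≫ ε ≫ biprod.snd) (by
      have : x ≫ ε ≫ biprod.fst = 0 := hx
      ext <;> simp [this]), pullback.lift_fst _ _ _⟩
  have hS' : IsProperExact P S := by
    refine ⟨.mk' hex inferInstance (epi_comp _ _), fun Y hY g => ?_⟩
    obtain ⟨g', hg'⟩ := hS.surjective Y hY (g ≫ biprod.inl)
    exact ⟨g', by simp [S, reassoc_of% hg']⟩
  exact resTilde_of_isProperExact hS' hX ((resTilde P).prop_of_iso e.symm (hK.biprod hD))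

lemma resTilde.of_isProperExact {S : ShortComplex 𝒜} (hA : resTilde P S.X₃)
    (hS : IsProperExact P S) (hX : P S.X₂) : resTilde P S.X₁ := by
  obtain ⟨K, Y, k, ε, w, hT, hY, hK⟩ := hA.exists_isProperExact
  obtain ⟨s, hs⟩ := hS.surjective Y hY ε
  obtain ⟨t, ht⟩ := hT.surjective S.X₂ hX S.g
  -- Schanuel: the pullback of the two surjections is both `S.X₁ ⊞ Y` and `K ⊞ S.X₂`.
  obtain ⟨e⟩ := nonempty_pullback_iso_biprod hS.shortExact s hs
  obtain ⟨e'⟩ := nonempty_pullback_iso_biprod hT.shortExact t ht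
  have : resTilde P (S.X₁ ⊞ Y) :=
    (resTilde P).prop_of_iso (e'.symm ≪≫ pullbackSymmetry ε S.g ≪≫ e) (hK.biprod hX)
  exact this.of_biprod hY

end AbelianCategory

section Ext

variable {𝒜 : Type u} [Category.{v} 𝒜] [Abelian 𝒜] [HasExt.{w} 𝒜]

lemma ExtVanish.of_retract {X Y Z : 𝒜} (h : ExtVanish.{w} X Y) (r : Retract Z Y) :
    ExtVanish.{w} X Z := fun n hn => by
  have := h n hn
  refine subsingleton_of_forall_eq 0 fun x => ?_
  calc x = (x.comp (Ext.mk₀ r.i) (add_zero n)).comp (Ext.mk₀ r.r) (add_zero n) := by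
        rw [Ext.comp_assoc_of_third_deg_zero, Ext.mk₀_comp_mk₀, r.retract, Ext.comp_mk₀_id]
    _ = 0 := by rw [Subsingleton.elim (x.comp (Ext.mk₀ r.i) _) 0, Ext.zero_comp]

variable {S : ShortComplex 𝒜}

lemma subsingleton_ext_one_iff_of_projective (hS : S.ShortExact) [Projective S.X₂] (Y : 𝒜) :
    Subsingleton (Ext.{w} S.X₃ Y 1) ↔ Function.Surjective (fun g : S.X₂ ⟶ Y => S.f ≫ g) := by
  refine ⟨fun h g => ?_, fun h => subsingleton_of_forall_eq 0 fun x => ?_⟩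
  · obtain ⟨x, hx⟩ := Ext.contravariant_sequence_exact₁ hS Y (Ext.mk₀ g) (add_zero 1)
      (Subsingleton.elim _ _)
    obtain ⟨x, rfl⟩ := (Ext.mk₀_bijective _ _).2 x
    exact ⟨x, (Ext.mk₀_bijective _ _).1 (by simpa only [Ext.mk₀_comp_mk₀] using hx)⟩
  · obtain ⟨y, rfl⟩ := Ext.contravariant_sequence_exact₃ hS Y x
      (Ext.eq_zero_of_projective _) (add_zero 1)
    obtain ⟨y, rfl⟩ := (Ext.mk₀_bijective _ _).2 y
    obtain ⟨z, rfl⟩ := h y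
    rw [← Ext.mk₀_comp_mk₀, ← Ext.comp_assoc_of_third_deg_zero, hS.extClass_comp, Ext.zero_comp]

lemma subsingleton_ext_one_iff_of_injective (hS : S.ShortExact) [Injective S.X₂] (Y : 𝒜) :
    Subsingleton (Ext.{w} Y S.X₁ 1) ↔ Function.Surjective (fun g : Y ⟶ S.X₂ => g ≫ S.g) := by
  refine ⟨fun h g => ?_, fun h => subsingleton_of_forall_eq 0 fun x => ?_⟩
  · obtain ⟨x, hx⟩ := Ext.covariant_sequence_exact₃ Y hS (Ext.mk₀ g) (zero_add 1)
      (Subsingleton.elim _ _)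
    obtain ⟨x, rfl⟩ := (Ext.mk₀_bijective _ _).2 x
    exact ⟨x, (Ext.mk₀_bijective _ _).1 (by simpa only [Ext.mk₀_comp_mk₀] using hx)⟩
  · obtain ⟨y, rfl⟩ := Ext.covariant_sequence_exact₁ Y hS x
      (Ext.eq_zero_of_injective _) (zero_add 1)
    obtain ⟨y, rfl⟩ := (Ext.mk₀_bijective _ _).2 y
    obtain ⟨z, rfl⟩ := h y
    rw [← Ext.mk₀_comp_mk₀, Ext.comp_assoc_of_second_deg_zero, hS.comp_extClass, Ext.comp_zero]

lemma subsingleton_ext_add_two_iff_of_projective (hS : S.ShortExact) [Projective S.X₂] (Y : 𝒜)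
    (n : ℕ) : Subsingleton (Ext.{w} S.X₃ Y (n + 2)) ↔ Subsingleton (Ext.{w} S.X₁ Y (n + 1)) := by
  refine ⟨fun h => subsingleton_of_forall_eq 0 fun x => ?_,
    fun h => subsingleton_of_forall_eq 0 fun x => ?_⟩
  · obtain ⟨y, rfl⟩ := Ext.contravariant_sequence_exact₁ hS Y x (add_comm 1 (n + 1))
      (Subsingleton.elim _ _)
    rw [Ext.eq_zero_of_projective y, Ext.comp_zero]
  · obtain ⟨y, rfl⟩ := Ext.contravariant_sequence_exact₃ hS Y x
      (Ext.eq_zero_of_projective _) (add_comm 1 (n + 1))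
    rw [Subsingleton.elim y 0, Ext.comp_zero]

lemma subsingleton_ext_add_two_iff_of_injective (hS : S.ShortExact) [Injective S.X₂] (Y : 𝒜)
    (n : ℕ) : Subsingleton (Ext.{w} Y S.X₁ (n + 2)) ↔ Subsingleton (Ext.{w} Y S.X₃ (n + 1)) := by
  refine ⟨fun h => subsingleton_of_forall_eq 0 fun x => ?_,
    fun h => subsingleton_of_forall_eq 0 fun x => ?_⟩
  · obtain ⟨y, rfl⟩ := Ext.covariant_sequence_exact₃ Y hS x (rfl : n + 1 + 1 = n + 2)
      (Subsingleton.elim _ _)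
    rw [Ext.eq_zero_of_injective y, Ext.zero_comp]
  · obtain ⟨y, rfl⟩ := Ext.covariant_sequence_exact₁ Y hS x
      (Ext.eq_zero_of_injective _) (rfl : n + 1 + 1 = n + 2)
    rw [Subsingleton.elim y 0, Ext.zero_comp]

end Ext

section AdditiveCharacters

variable {M N P : Type*} [AddCommGroup M] [AddCommGroup N] [AddCommGroup P]

lemma exists_character_comp_eq_of_injective {f : M →+ N} (hf : Function.Injective f)
    (φ : M →+ AddCircle (1 : ℚ)) : ∃ ψ : N →+ AddCircle (1 : ℚ), ψ.comp f = φ :=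
  CharacterModule.dual_surjective_of_injective f.toIntLinearMap hf φ

lemma exists_character_comp_eq_of_exact {f : M →+ N} {g : N →+ P} (h : Function.Exact f g)
    {φ : N →+ AddCircle (1 : ℚ)} (hφ : φ.comp f = 0) :
    ∃ ψ : P →+ AddCircle (1 : ℚ), ψ.comp g = φ := by
  have hker : g.ker ≤ φ.ker := fun x hx => by
    obtain ⟨y, rfl⟩ := (h x).1 hx
    exact DFunLike.congr_fun hφ y
  obtain ⟨ψ, hψ⟩ := exists_character_comp_eq_of_injective (QuotientAddGroup.kerLift_injective g)
    (QuotientAddGroup.lift g.ker φ hker)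
  exact ⟨ψ, AddMonoidHom.ext fun x => DFunLike.congr_fun hψ (QuotientAddGroup.mk x)⟩

lemma exists_character_comp_eq_zero_of_notMem_range {f : M →+ N} {x : N} (hx : x ∉ f.range) :
    ∃ φ : N →+ AddCircle (1 : ℚ), φ.comp f = 0 ∧ φ x ≠ 0 := by
  obtain ⟨φ, hφ⟩ : ∃ φ : N ⧸ f.range →+ AddCircle (1 : ℚ), φ x ≠ 0 :=
    CharacterModule.exists_character_apply_ne_zero_of_ne_zero
      (mt (QuotientAddGroup.eq_zero_iff x).1 hx)
  refine ⟨φ.comp (QuotientAddGroup.mk' f.range), AddMonoidHom.ext fun y => ?_, hφ⟩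
  have : QuotientAddGroup.mk' f.range (f y) = 0 := (QuotientAddGroup.eq_zero_iff _).2 ⟨y, rfl⟩
  rw [AddMonoidHom.comp_apply, AddMonoidHom.comp_apply, this, map_zero, AddMonoidHom.zero_apply]

end AdditiveCharacters

section Character

variable {R : Type u} [Ring R]

/-- The elements of `M⁺`, for a left module `M`, as additive characters of `M`. -/
def charRightEquiv (M : ModuleCat.{u} R) : charRight M ≃+ (M →+ AddCircle (1 : ℚ)) :=
  AddEquiv.refl _

/-- The elements of `N⁺`, for a right module `N`, as additive characters of `N`. -/
def charLeftEquiv (N : ModuleCat.{u} Rᵐᵒᵖ) : charLeft N ≃+ (N →+ AddCircle (1 : ℚ)) :=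
  AddEquiv.refl _

@[simp]
lemma charRightEquiv_smul (M : ModuleCat.{u} R) (r : Rᵐᵒᵖ) (φ : charRight M) (x : M) :
    charRightEquiv M (r • φ) x = charRightEquiv M φ (unop r • x) := rfl

@[simp]
lemma charLeftEquiv_smul (N : ModuleCat.{u} Rᵐᵒᵖ) (r : R) (φ : charLeft N) (x : N) :
    charLeftEquiv N (r • φ) x = charLeftEquiv N φ (op r • x) := rfl

lemma charRight_ext {M : ModuleCat.{u} R} {φ ψ : charRight M}
    (h : ∀ x, charRightEquiv M φ x = charRightEquiv M ψ x) : φ = ψ :=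
  (charRightEquiv M).injective (AddMonoidHom.ext h)

lemma charLeft_ext {N : ModuleCat.{u} Rᵐᵒᵖ} {φ ψ : charLeft N}
    (h : ∀ x, charLeftEquiv N φ x = charLeftEquiv N ψ x) : φ = ψ :=
  (charLeftEquiv N).injective (AddMonoidHom.ext h)

/-- The map `f⁺ : N⁺ ⟶ M⁺` induced by a map `f : M ⟶ N` of left modules. -/
def charRightMap {M N : ModuleCat.{u} R} (f : M ⟶ N) : charRight N ⟶ charRight M :=
  ModuleCat.ofHom (X := charRight N) (Y := charRight M)
    { toFun φ := (charRightEquiv M).symm ((charRightEquiv N φ).comp f.hom.toAddMonoidHom)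
      map_add' _ _ := rfl
      map_smul' r φ := charRight_ext fun x =>
        congrArg (charRightEquiv N φ) (f.hom.map_smul (unop r) x).symm }

/-- The map `f⁺ : N⁺ ⟶ M⁺` induced by a map `f : M ⟶ N` of right modules. -/
def charLeftMap {M N : ModuleCat.{u} Rᵐᵒᵖ} (f : M ⟶ N) : charLeft N ⟶ charLeft M :=
  ModuleCat.ofHom (X := charLeft N) (Y := charLeft M)
    { toFun φ := (charLeftEquiv M).symm ((charLeftEquiv N φ).comp f.hom.toAddMonoidHom)
      map_add' _ _ := rfl
      map_smul' r φ := charLeft_ext fun x =>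
        congrArg (charLeftEquiv N φ) (f.hom.map_smul (op r) x).symm }

lemma charRightMap_comp {M N P : ModuleCat.{u} R} (f : M ⟶ N) (g : N ⟶ P) :
    charRightMap (f ≫ g) = charRightMap g ≫ charRightMap f := rfl

lemma charRightMap_zero (M N : ModuleCat.{u} R) : charRightMap (0 : M ⟶ N) = 0 := by
  ext φ
  exact charRight_ext fun _ => map_zero (charRightEquiv N φ)

lemma epi_charRightMap {M N : ModuleCat.{u} R} (f : M ⟶ N) [hf : Mono f] :
    Epi (charRightMap f) :=
  (ModuleCat.epi_iff_surjective _).2 fun φ =>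
    exists_character_comp_eq_of_injective (f := f.hom.toAddMonoidHom)
      ((ModuleCat.mono_iff_injective f).1 hf) φ

lemma epi_charLeftMap {M N : ModuleCat.{u} Rᵐᵒᵖ} (f : M ⟶ N) [hf : Mono f] :
    Epi (charLeftMap f) :=
  (ModuleCat.epi_iff_surjective _).2 fun φ =>
    exists_character_comp_eq_of_injective (f := f.hom.toAddMonoidHom)
      ((ModuleCat.mono_iff_injective f).1 hf) φ

lemma mono_charRightMap {M N : ModuleCat.{u} R} (f : M ⟶ N) [hf : Epi f] :
    Mono (charRightMap f) :=
  (ModuleCat.mono_iff_injective _).2 fun _ _ h => charRight_ext fun x => by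
    obtain ⟨y, rfl⟩ := (ModuleCat.epi_iff_surjective f).1 hf x
    exact congrArg (fun χ => charRightEquiv M χ y) h

/-- The complex `X₃⁺ ⟶ X₂⁺ ⟶ X₁⁺` of right modules attached to a complex `X₁ ⟶ X₂ ⟶ X₃`. -/
def charRightShortComplex (S : ShortComplex (ModuleCat.{u} R)) :
    ShortComplex (ModuleCat.{u} Rᵐᵒᵖ) :=
  .mk (charRightMap S.g) (charRightMap S.f) (by
    rw [← charRightMap_comp, S.zero, charRightMap_zero])

variable {S : ShortComplex (ModuleCat.{u} R)}

lemma exact_charRightShortComplex (hS : S.Exact) : (charRightShortComplex S).Exact :=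
  (ShortComplex.moduleCat_exact_iff _).2 fun _ hφ =>
    exists_character_comp_eq_of_exact (f := S.f.hom.toAddMonoidHom) (g := S.g.hom.toAddMonoidHom)
      ((ShortComplex.ShortExact.moduleCat_exact_iff_function_exact S).1 hS) hφ

lemma shortExact_charRightShortComplex (hS : S.ShortExact) :
    (charRightShortComplex S).ShortExact :=
  have := hS.mono_f
  have := hS.epi_g
  .mk' (exact_charRightShortComplex hS.exact) (mono_charRightMap S.g) (epi_charRightMap S.f)

/-- Transposition `Hom(A, D⁺) ≃ Hom(D, A⁺)`: both sides consist of the balanced pairings of `D`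
and `A` with values in `ℚ/ℤ`. -/
def homCharEquiv (A : ModuleCat.{u} R) (D : ModuleCat.{u} Rᵐᵒᵖ) :
    (A ⟶ charLeft D) ≃ (D ⟶ charRight A) where
  toFun g := ModuleCat.ofHom (X := D) (Y := charRight A)
    { toFun d := (charRightEquiv A).symm
        (((charLeftEquiv D).toAddMonoidHom.comp g.hom.toAddMonoidHom).flip d)
      map_add' _ _ := charRight_ext fun a => map_add (charLeftEquiv D (g.hom a)) _ _
      map_smul' r d := charRight_ext fun a =>
        (congrArg (fun φ => charLeftEquiv D φ d) (g.hom.map_smul (unop r) a)).symm }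
  invFun g := ModuleCat.ofHom (X := A) (Y := charLeft D)
    { toFun a := (charLeftEquiv D).symm
        (((charRightEquiv A).toAddMonoidHom.comp g.hom.toAddMonoidHom).flip a)
      map_add' _ _ := charLeft_ext fun d => map_add (charRightEquiv A (g.hom d)) _ _
      map_smul' r a := charLeft_ext fun d =>
        (congrArg (fun φ => charRightEquiv A φ a) (g.hom.map_smul (op r) d)).symm }
  left_inv _ := rfl
  right_inv _ := rfl

lemma homCharEquiv_symm_apply {A : ModuleCat.{u} R} {D : ModuleCat.{u} Rᵐᵒᵖ}
    (g : D ⟶ charRight A) (a : A) (d : D) :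
    charLeftEquiv D (((homCharEquiv A D).symm g).hom a) d = charRightEquiv A (g.hom d) a := rfl

lemma homCharEquiv_zero (A : ModuleCat.{u} R) (D : ModuleCat.{u} Rᵐᵒᵖ) :
    homCharEquiv A D 0 = 0 := rfl

lemma homCharEquiv_comp {A B : ModuleCat.{u} R} {D : ModuleCat.{u} Rᵐᵒᵖ} (f : A ⟶ B)
    (g : B ⟶ charLeft D) : homCharEquiv A D (f ≫ g) = homCharEquiv B D g ≫ charRightMap f := rfl

lemma homCharEquiv_comp_charLeftMap {A : ModuleCat.{u} R} {D E : ModuleCat.{u} Rᵐᵒᵖ} (f : D ⟶ E)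
    (g : A ⟶ charLeft E) : homCharEquiv A D (g ≫ charLeftMap f) = f ≫ homCharEquiv A E g := rfl

lemma mono_homCharEquiv_symm {A : ModuleCat.{u} R} {D : ModuleCat.{u} Rᵐᵒᵖ}
    (t : D ⟶ charRight A) [ht : Epi t] : Mono ((homCharEquiv A D).symm t) := by
  refine (ModuleCat.mono_iff_injective _).2 <| (injective_iff_map_eq_zero _).2 fun a ha =>
    CharacterModule.eq_zero_of_character_apply fun φ => ?_
  obtain ⟨d, hd⟩ := (ModuleCat.epi_iff_surjective t).1 ht ((charRightEquiv A).symm φ)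
  calc φ a = charRightEquiv A (t.hom d) a := (congrArg (fun ψ => charRightEquiv A ψ a) hd).symm
    _ = charLeftEquiv D (((homCharEquiv A D).symm t).hom a) d :=
      (homCharEquiv_symm_apply t a d).symm
    _ = 0 := by rw [ha, map_zero, AddMonoidHom.zero_apply]

lemma surjective_comp_charLeft_iff {A B : ModuleCat.{u} R} (f : A ⟶ B)
    (D : ModuleCat.{u} Rᵐᵒᵖ) : Function.Surjective (fun g : B ⟶ charLeft D => f ≫ g) ↔
      Function.Surjective (fun g : D ⟶ charRight B => g ≫ charRightMap f) := by
  rw [← (homCharEquiv A D).comp_surjective, ← (homCharEquiv B D).surjective_comp]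
  rfl

lemma exact_comp_charLeft_iff {A B C : ModuleCat.{u} R} (f : A ⟶ B) (f' : B ⟶ C)
    (D : ModuleCat.{u} Rᵐᵒᵖ) :
    Function.Exact (fun g : C ⟶ charLeft D => f' ≫ g) (fun g : B ⟶ charLeft D => f ≫ g) ↔
      Function.Exact (fun g : D ⟶ charRight C => g ≫ charRightMap f')
        (fun g : D ⟶ charRight B => g ≫ charRightMap f) := by
  refine (homCharEquiv B D).forall_congr fun g => iff_congr ?_ ?_
  · simp only [← homCharEquiv_comp, ← homCharEquiv_zero, (homCharEquiv A D).apply_eq_iff_eq]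
  · simp only [Set.mem_range]
    rw [← (homCharEquiv C D).exists_congr_right]
    simp only [← homCharEquiv_comp, (homCharEquiv B D).apply_eq_iff_eq]

lemma injective_charRight (P : ModuleCat.{u} R) [Projective P] : Injective (charRight P) where
  factors {X Y} g f _ := by
    have := epi_charLeftMap f
    let h : P ⟶ charLeft Y := Projective.factorThru ((homCharEquiv P X).symm g) (charLeftMap f)
    refine ⟨homCharEquiv P Y h, ?_⟩
    rw [← homCharEquiv_comp_charLeftMap, Projective.factorThru_comp, Equiv.apply_symm_apply]

lemma subsingleton_ext_charLeft_iff (A : ModuleCat.{u} R) (D : ModuleCat.{u} Rᵐᵒᵖ) (n : ℕ) :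
    Subsingleton (Ext.{u} A (charLeft D) (n + 1)) ↔
      Subsingleton (Ext.{u} D (charRight A) (n + 1)) := by
  have hS (A : ModuleCat.{u} R) := A.shortExact_projectiveShortComplex
  have hS' (A : ModuleCat.{u} R) := shortExact_charRightShortComplex (hS A)
  have (A : ModuleCat.{u} R) : Projective A.projectiveShortComplex.X₂ := inferInstance
  have (A : ModuleCat.{u} R) : Injective (charRightShortComplex A.projectiveShortComplex).X₂ :=
    injective_charRight _
  induction n generalizing A with
  | zero =>
    exact (subsingleton_ext_one_iff_of_projective (hS A) _).trans <|
      (surjective_comp_charLeft_iff _ D).trans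
        (subsingleton_ext_one_iff_of_injective (hS' A) D).symm
  | succ n ih =>
    exact (subsingleton_ext_add_two_iff_of_projective (hS A) _ n).trans <|
      (ih _).trans (subsingleton_ext_add_two_iff_of_injective (hS' A) D n).symm

lemma extVanish_charLeft_iff (A : ModuleCat.{u} R) (D : ModuleCat.{u} Rᵐᵒᵖ) :
    ExtVanish.{u} A (charLeft D) ↔ ExtVanish.{u} D (charRight A) := by
  refine forall_congr' fun n => forall_congr' fun hn => ?_
  obtain ⟨n, rfl⟩ := Nat.exists_eq_add_of_le' hn
  exact subsingleton_ext_charLeft_iff A D n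

end Character

section Purity

variable {R : Type*} [Ring R] {M N L : Type*} [AddCommGroup M] [AddCommGroup N] [AddCommGroup L]
  [Module R M] [Module R N] [Module R L]

/-- The equational form of purity of a map `f : M → N`: every finite system of linear equations
with constants in `M` which has a solution in `N` has a solution in `M`. -/
def ReflectsSolvability (f : M →ₗ[R] N) : Prop :=
  ∀ (m n : ℕ) (r : Fin m → Fin n → R) (c : Fin m → M),
    (∃ y : Fin n → N, ∀ i, ∑ j, r i j • y j = f (c i)) →
      ∃ x : Fin n → M, ∀ i, ∑ j, r i j • x j = c i

lemma ReflectsSolvability.exists_comp_eq {f : M →ₗ[R] N} (hf : ReflectsSolvability f) {m n : ℕ}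
    {g : (Fin m → R) →ₗ[R] Fin n → R} {u : (Fin m → R) →ₗ[R] M} {q : (Fin n → R) →ₗ[R] N}
    (h : q ∘ₗ g = f ∘ₗ u) : ∃ x : (Fin n → R) →ₗ[R] M, x ∘ₗ g = u := by
  have hq (v : Fin n → R) : ∑ j, v j • q (Pi.single j 1) = q v := by
    conv_rhs => rw [pi_eq_sum_univ' v, map_sum]
    simp only [map_smul]
  obtain ⟨x, hx⟩ := hf m n (fun i => g (Pi.single i 1)) (fun i => u (Pi.single i 1))
    ⟨fun j => q (Pi.single j 1), fun i => (hq _).trans (LinearMap.congr_fun h _)⟩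
  exact ⟨Fintype.linearCombination R x, LinearMap.pi_ext' fun i => LinearMap.ext_ring (hx i)⟩

lemma ReflectsSolvability.exists_lift {f : M →ₗ[R] N} (hf : ReflectsSolvability f)
    {p : N →ₗ[R] L} (hfp : Function.Exact f p) (hp : Function.Surjective p) {F : Type*}
    [AddCommGroup F] [Module R F] [Module.FinitePresentation R F] (h : F →ₗ[R] L) :
    ∃ h' : F →ₗ[R] N, p ∘ₗ h' = h := by
  obtain ⟨n, m, π, g, hπ, hgπ⟩ := Module.FinitePresentation.exists_fin' R F
  obtain ⟨q, hq⟩ := Module.projective_lifting_property p (h ∘ₗ π) hp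
  have hpqg : p ∘ₗ q ∘ₗ g = 0 := by
    rw [← LinearMap.comp_assoc, hq, LinearMap.comp_assoc, hgπ.linearMap_comp_eq_zero,
      LinearMap.comp_zero]
  obtain ⟨u, hu⟩ := Module.projective_lifting_property f.rangeRestrict
    ((q ∘ₗ g).codRestrict _ fun v => (hfp _).1 (LinearMap.congr_fun hpqg v))
    f.surjective_rangeRestrict
  replace hu : q ∘ₗ g = f ∘ₗ u := congrArg ((LinearMap.range f).subtype ∘ₗ ·) hu.symm
  -- On relations `q` agrees with `f ∘ x`, so `q - f ∘ x` descends to `F`, still lifting `h`.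
  obtain ⟨x, hx⟩ := hf.exists_comp_eq hu
  have hker : LinearMap.range g ≤ LinearMap.ker (q - f ∘ₗ x) := by
    rw [LinearMap.range_le_ker_iff, LinearMap.sub_comp, LinearMap.comp_assoc, hx, hu, sub_self]
  refine ⟨(LinearMap.range g).liftQ _ hker ∘ₗ (hgπ.linearEquivOfSurjective hπ).symm.toLinearMap,
    LinearMap.ext fun y => ?_⟩
  obtain ⟨v, rfl⟩ := hπ y
  calc p ((LinearMap.range g).liftQ _ hker ((hgπ.linearEquivOfSurjective hπ).symm (π v)))
      = p (q v - f (x v)) := by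
        rw [Function.Exact.linearEquivOfSurjective_symm_apply, Submodule.liftQ_apply]; rfl
    _ = h (π v) := by
        rw [map_sub, hfp.apply_apply_eq_zero, sub_zero]; exact LinearMap.congr_fun hq v

end Purity

section PureInjective

variable {R : Type u} [Ring R]

lemma ReflectsSolvability.isPureExact {S : ShortComplex (ModuleCat.{u} R)} (hS : S.ShortExact)
    (hf : ReflectsSolvability S.f.hom) : IsPureExact S := by
  have := hS.mono_f
  refine ⟨hS, fun M _ => ⟨fun a b hab => (cancel_mono S.f).1 hab, fun h => ⟨fun hh => ?_, ?_⟩,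
    fun h => ?_⟩⟩
  · exact ⟨hS.exact.lift h hh, hS.exact.lift_f h hh⟩
  · rintro ⟨k, rfl⟩
    simp
  · obtain ⟨h', hh'⟩ := hf.exists_lift
      ((ShortComplex.ShortExact.moduleCat_exact_iff_function_exact S).1 hS.exact)
      hS.moduleCat_surjective_g h.hom
    exact ⟨ModuleCat.ofHom h', ModuleCat.hom_ext hh'⟩

/-- The canonical map from a module to its double character module. -/
def evaluation (C : ModuleCat.{u} R) : C ⟶ charLeft (charRight C) :=
  (homCharEquiv C (charRight C)).symm (𝟙 _)

lemma evaluation_apply {C : ModuleCat.{u} R} (x : C) (φ : charRight C) :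
    charLeftEquiv _ ((evaluation C).hom x) φ = charRightEquiv C φ x := rfl

instance (C : ModuleCat.{u} R) : Mono (evaluation C) := mono_homCharEquiv_symm (𝟙 _)

lemma exists_sum_charRight_eq {C : ModuleCat.{u} R} {ι : Type*} [Fintype ι]
    (φ : (ι → C) →+ AddCircle (1 : ℚ)) :
    ∃ ψ : ι → charRight C, ∀ y, ∑ i, charRightEquiv C (ψ i) (y i) = φ y := by
  classical
  refine ⟨fun i => (charRightEquiv C).symm (φ.comp (AddMonoidHom.single (fun _ => C) i)),
    fun y => ?_⟩
  conv_rhs => rw [← Finset.univ_sum_single y, map_sum]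
  rfl

lemma reflectsSolvability_evaluation (C : ModuleCat.{u} R) :
    ReflectsSolvability (evaluation C).hom := by
  rintro m n r c ⟨q, hq⟩
  let T : (Fin n → C) →+ (Fin m → C) :=
    { toFun x i := ∑ j, r i j • x j
      map_zero' := by ext; simp
      map_add' _ _ := by ext; simp [Finset.sum_add_distrib] }
  -- If `T x = c` has no solution in `C`, then some character `φ = (ψ i)` vanishes on the range of
  -- `T` but not at `c`; evaluating the solution `q` at the relations among the `ψ i` kills `φ c`.
  suffices c ∈ T.range from this.imp fun x hx => congrFun hx
  by_contra hc
  obtain ⟨φ, hφT, hφc⟩ := exists_character_comp_eq_zero_of_notMem_range hc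
  obtain ⟨ψ, hψ⟩ := exists_sum_charRight_eq φ
  have hrel : ∀ j, ∑ i, op (r i j) • ψ i = 0 := fun j => charRight_ext fun x => by
    calc charRightEquiv C (∑ i, op (r i j) • ψ i) x
        = ∑ i, charRightEquiv C (ψ i) (T (Pi.single j x) i) := by
          simp [T, Pi.single_apply]
      _ = φ (T (Pi.single j x)) := hψ _
      _ = charRightEquiv C 0 x := by rw [map_zero]; exact DFunLike.congr_fun hφT _
  refine hφc ?_
  calc φ c = ∑ i, charRightEquiv C (ψ i) (c i) := (hψ c).symm
    _ = ∑ i, ∑ j, charLeftEquiv _ (q j) (op (r i j) • ψ i) := Finset.sum_congr rfl fun i _ => by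
        rw [← evaluation_apply, ← hq i]
        simp
    _ = ∑ j, charLeftEquiv _ (q j) (∑ i, op (r i j) • ψ i) := by
        rw [Finset.sum_comm]
        simp only [map_sum]
    _ = 0 := by simp only [hrel, map_zero, Finset.sum_const_zero]

lemma IsPureInjective.nonempty_retract {C : ModuleCat.{u} R} (hC : IsPureInjective C) :
    Nonempty (Retract C (charLeft (charRight C))) := by
  have hS : (ShortComplex.mk (evaluation C) (cokernel.π _) (cokernel.condition _)).ShortExact :=
    .mk' (ShortComplex.exact_cokernel _) inferInstance inferInstance
  obtain ⟨ρ, hρ⟩ := (hC _ ((reflectsSolvability_evaluation C).isPureExact hS)).2.2 (𝟙 C)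
  exact ⟨⟨evaluation C, ρ, hρ⟩⟩

end PureInjective

section Gorenstein

variable {R : Type u} [Ring R]

lemma IsCoresolution.isResolution_charRight {A : ModuleCat.{u} R} {X : ℕ → ModuleCat.{u} R}
    {ε : A ⟶ X 0} {d : ∀ i, X i ⟶ X (i + 1)} (h : IsCoresolution ε d) :
    IsResolution (A := charRight A) (X := fun i => charRight (X i)) (charRightMap ε)
      (fun i => charRightMap (d i)) := by
  have := h.mono
  refine ⟨epi_charRightMap ε, ?_, fun i => ?_⟩
  · obtain ⟨_, hex⟩ := h.exact_zero
    exact ⟨_, exact_charRightShortComplex hex⟩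
  · obtain ⟨_, hex⟩ := h.exact_succ i
    exact ⟨_, exact_charRightShortComplex hex⟩

lemma HomIntoExact.homFromExact_charRight {A : ModuleCat.{u} R} {X : ℕ → ModuleCat.{u} R}
    {ε : A ⟶ X 0} {d : ∀ i, X i ⟶ X (i + 1)} {D : ModuleCat.{u} Rᵐᵒᵖ}
    (h : HomIntoExact ε d (charLeft D)) :
    HomFromExact (A := charRight A) (X := fun i => charRight (X i)) (charRightMap ε)
      (fun i => charRightMap (d i)) D :=
  ⟨(surjective_comp_charLeft_iff ε D).1 h.surjective,
    (exact_comp_charLeft_iff ε (d 0) D).1 h.exact_zero,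
    fun i => (exact_comp_charLeft_iff (d i) (d (i + 1)) D).1 (h.exact_succ i)⟩

variable {𝒞 : ObjectProperty (ModuleCat.{u} R)} {𝒟 : ObjectProperty (ModuleCat.{u} Rᵐᵒᵖ)}

lemma coresTilde.resTilde_charRight (ha₁ : ∀ D, 𝒟 D → 𝒞 (charLeft D))
    (ha₂ : ∀ C, 𝒞 C → 𝒟 (charRight C)) {A : ModuleCat.{u} R} (hA : coresTilde 𝒞 A) :
    resTilde 𝒟 (charRight A) := by
  obtain ⟨X, ε, d, hX, hres, hom⟩ := hA
  exact ⟨fun i => charRight (X i), charRightMap ε, fun i => charRightMap (d i),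
    fun i => ha₂ _ (hX i), hres.isResolution_charRight,
    fun D hD => (hom _ (ha₁ D hD)).homFromExact_charRight⟩

lemma IsPreenvelope.mono_of_epi_charRight (ha₁ : ∀ D, 𝒟 D → 𝒞 (charLeft D))
    {A X : ModuleCat.{u} R} {f : A ⟶ X} (hf : IsPreenvelope 𝒞 f) {D : ModuleCat.{u} Rᵐᵒᵖ}
    (hD : 𝒟 D) (t : D ⟶ charRight A) [Epi t] : Mono f := by
  obtain ⟨g, hg⟩ := hf.2 _ (ha₁ D hD) ((homCharEquiv A D).symm t)
  have := mono_homCharEquiv_symm t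
  exact mono_of_mono_fac hg

lemma coresTilde_of_resTilde_charRight [𝒟.IsClosedUnderBinaryProducts]
    (ha₁ : ∀ D, 𝒟 D → 𝒞 (charLeft D)) (ha₂ : ∀ C, 𝒞 C → 𝒟 (charRight C))
    (hb : IsPreenveloping 𝒞) {A : ModuleCat.{u} R} (hA : resTilde 𝒟 (charRight A)) :
    coresTilde 𝒞 A := by
  refine coresTilde_of_forall_exists_preenvelope (Q := fun A => resTilde 𝒟 (charRight A))
    (fun A hA => ?_) hA
  obtain ⟨X, f, hf⟩ := hb A
  have : Mono f := by
    obtain ⟨Y, ε, _, hY, hres, _⟩ := hA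
    have := hres.epi
    exact hf.mono_of_epi_charRight ha₁ (hY 0) ε
  have hS : (ShortComplex.mk f (cokernel.π f) (cokernel.condition f)).ShortExact :=
    .mk' (ShortComplex.exact_cokernel f) inferInstance inferInstance
  have hS' : IsProperExact 𝒟 (charRightShortComplex (.mk f _ (cokernel.condition f))) :=
    ⟨shortExact_charRightShortComplex hS,
      fun D hD => (surjective_comp_charLeft_iff f D).1 (hf.2 _ (ha₁ D hD))⟩
  exact ⟨X, _, f, _, _, hf, hS, resTilde.of_isProperExact hA hS' (ha₂ X hf.1)⟩

end Gorenstein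

end GorensteinSub

open GorensteinSub in
theorem proposition3p2_general {R : Type u} [Ring R]
    (𝒞 : ObjectProperty (ModuleCat.{u} R)) (𝒟 : ObjectProperty (ModuleCat.{u} Rᵐᵒᵖ))
    [𝒟.IsClosedUnderBinaryProducts] (ha₁ : ∀ D, 𝒟 D → 𝒞 (charLeft D))
    (ha₂ : ∀ C, 𝒞 C → 𝒟 (charRight C)) (hb₁ : IsPreenveloping 𝒞)
    (hb₂ : ∀ C, 𝒞 C → IsPureInjective C) (A : ModuleCat.{u} R) :
    rightGorenstein.{u} 𝒞 A ↔ leftGorenstein.{u} 𝒟 (charRight A) := by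
  have hperp : leftPerp.{u} 𝒞 A ↔ rightPerp.{u} 𝒟 (charRight A) := by
    refine ⟨fun h D hD => (extVanish_charLeft_iff A D).1 (h _ (ha₁ D hD)), fun h C hC => ?_⟩
    obtain ⟨r⟩ := (hb₂ C hC).nonempty_retract
    exact ((extVanish_charLeft_iff A _).2 (h _ (ha₂ C hC))).of_retract r
  have htilde : coresTilde 𝒞 A ↔ resTilde 𝒟 (charRight A) :=
    ⟨fun h => h.resTilde_charRight ha₁ ha₂, coresTilde_of_resTilde_charRight ha₁ ha₂ hb₁⟩
  exact and_congr hperp htilde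

theorem proposition3p2 {R : Type u} [Ring R]
    (𝒞 : ObjectProperty (ModuleCat.{u} R)) (𝒟 : ObjectProperty (ModuleCat.{u} Rᵐᵒᵖ))
    [𝒞.IsClosedUnderIsomorphisms] [𝒞.IsClosedUnderFiniteProducts]
    [𝒟.IsClosedUnderIsomorphisms] [𝒟.IsClosedUnderFiniteProducts]
    (ha₁ : ∀ D : ModuleCat.{u} Rᵐᵒᵖ, 𝒟 D → 𝒞 (GorensteinSub.charLeft D))
    (ha₂ : ∀ C : ModuleCat.{u} R, 𝒞 C → 𝒟 (GorensteinSub.charRight C))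
    (hb₁ : GorensteinSub.IsPreenveloping 𝒞)
    (hb₂ : ∀ C : ModuleCat.{u} R, 𝒞 C → GorensteinSub.IsPureInjective C)
    (hc : ∀ (D : ModuleCat.{u} Rᵐᵒᵖ) (C : ModuleCat.{u} R), 𝒟 D → 𝒞 C →
      GorensteinSub.ExtVanish.{u} D (GorensteinSub.charRight C))
    (A : ModuleCat.{u} R) :
    GorensteinSub.rightGorenstein.{u} 𝒞 A ↔
      GorensteinSub.leftGorenstein.{u} 𝒟 (GorensteinSub.charRight A) :=
  proposition3p2_general 𝒞 𝒟 ha₁ ha₂ hb₁ hb₂ A
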